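/- Consider the decoupled multi-armed bandit problem with a fixed set of $k$ actions and a known horizon $T$. The rewards $g_i(t)$ ($i\in[k]$, $1\le t\le T$) are fixed in advance, and unknown to the algorithm. In each round $t$ the algorithm plays an action $i_t$ and queries an action $j_t$, and the reward $g_{j_t}(t)$ of the queried action, and nothing else, is revealed to it at the end of the round; $i_t$ may depend on the algorithm's own randomness and on what was revealed in the rounds before $t$. The regret is $\max_{i\in[k]}\sum_{t=1}^T g_i(t)-\sum_{t=1}^T g_{i_t}(t)$. The algorithm queries according to a fixed distribution if $j_1,\dots,j_T$ are independent draws from one probability distribution on $[k]$, independent of the rewards. There are universal constants $c>0$, $\Delta>0$ and $m\in\mathbb N$ such that the following holds for all integers $k>2$ and $T\ge k$. For every (randomized) algorithm with $k$ actions and horizon $T$ that queries according to a fixed distribution, there are probability distributions $\nu_1,\dots,\nu_k$ supported on $[0,1]$ and a set $G\subsetneq[k]$ with $|G|=m\geq 1$, such that the mean of $\nu_i$ exceeds the mean of $\nu_j$ by at least $\Delta$ for all $i\in G$ and $j\in[k]\setminus G$, and such that, if all rewards $g_i(t)$ are drawn independently (and independently of the algorithm's randomness), with $g_i(t)\sim\nu_i$,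 the expected regret of the algorithm is at least $c\sqrt{kT}$. -/

import Mathlib

open MeasureTheory ProbabilityTheory

/-- A (randomized) decoupled bandit algorithm with `k` actions and known horizon `T`, all of whose
randomness is carried by the probability space `(Ω, P)`, and which queries the actions according
to a fixed distribution: in the rounds `t` the queried actions `j_t = query t` are independent
draws from one distribution `queryDist` on the actions, whatever rewards have been observed.

The action `i_t` that is played in round `t` may depend on the randomness of the algorithm (hence
in particular on the queried actions and on a private random seed), and on the rewards
`g_{j_s}(s)` that were revealed by the queries in the earlier rounds `s < t`, but on nothing else
about the rewards. -/
structure FixedQueryAlgorithm (k T : ℕ) {Ω : Type*} [MeasurableSpace Ω] (P : Measure Ω) where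
  /-- the fixed query distribution -/
  queryDist : PMF (Fin k)
  /-- the action that is queried in round `t` -/
  query : Fin T → Ω → Fin k
  measurable_query : ∀ t, Measurable (query t)
  map_query : ∀ t, P.map (query t) = queryDist.toMeasure
  iIndepFun_query : iIndepFun query P
  /-- the action that is played in round `t`, given the randomness of the algorithm and the
  rewards revealed in the rounds before `t` -/
  act : (t : Fin T) → Ω → (Set.Iio t → ℝ) → Fin k
  measurable_act : ∀ t, Measurable (fun p : Ω × (Set.Iio t → ℝ) => act t p.1 p.2)

namespace FixedQueryAlgorithm

variable {k T : ℕ} {Ω : Type*} [MeasurableSpace Ω] {P : Measure Ω}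

/-- The action `i_t` played in round `t` when the algorithm faces the reward table `g`, where
`g s i` is the reward of action `i` in round `s`. -/
def play (A : FixedQueryAlgorithm k T P) (g : Fin T → Fin k → ℝ) (ω : Ω) (t : Fin T) : Fin k :=
  A.act t ω (fun s => g s.1 (A.query s.1 ω))

/-- The regret `max_i ∑_t g_i(t) - ∑_t g_{i_t}(t)`. -/
noncomputable def regret (A : FixedQueryAlgorithm k T P) (g : Fin T → Fin k → ℝ) (ω : Ω) : ℝ :=
  (⨆ i : Fin k, ∑ t : Fin T, g t i) - ∑ t : Fin T, g t (A.play g ω t)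

end FixedQueryAlgorithm

/-- The law of the reward table `g` when the rewards `g t i` are all independent, and those of
action `i` are identically distributed with law `ν i`. -/
noncomputable def rewardLaw {k : ℕ} (T : ℕ) (ν : Fin k → ProbabilityMeasure ℝ) :
    Measure (Fin T → Fin k → ℝ) :=
  Measure.pi fun _ : Fin T => Measure.pi fun i : Fin k => (ν i : Measure ℝ)

/-- The expected regret of the algorithm, over its own randomness and the independent rewards. -/
noncomputable def FixedQueryAlgorithm.expectedRegret {k T : ℕ} {Ω : Type*} [MeasurableSpace Ω]
    {P : Measure Ω} (A : FixedQueryAlgorithm k T P) (ν : Fin k → ProbabilityMeasure ℝ) : ℝ :=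
  ∫ z, A.regret z.2 z.1 ∂(P.prod (rewardLaw T ν))

/-- The reward distributions `ν i` are supported on `[0,1]`, and there is a set `G` of `m` good
actions (not empty, and not all the actions) such that the mean reward of every action in `G`
exceeds the mean reward of every action outside `G` by at least `Δ`. -/
def HasGoodActions {k : ℕ} (ν : Fin k → ProbabilityMeasure ℝ) (m : ℕ) (Δ : ℝ) : Prop :=
  (∀ i, ∀ᵐ x ∂(ν i : Measure ℝ), x ∈ Set.Icc (0 : ℝ) 1) ∧
  ∃ G : Finset (Fin k), G.Nonempty ∧ G ≠ Finset.univ ∧ G.card = m ∧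
    ∀ i ∈ G, ∀ j ∉ G, (∫ x, x ∂(ν j : Measure ℝ)) + Δ ≤ ∫ x, x ∂(ν i : Measure ℝ)

/-! The bound is a two-point argument on the arm that is queried least. A fixed query distribution
gives some arm `b` mass at most `1/k`, so `b` is queried at most `T/k` times in expectation. Let
another arm `a` pay exactly `1/2`, let the remaining arms pay `0`, and let `b` toss a coin of bias
`1/2 + ε` or `1/2 - ε`. Both `a` and `b` are good in either case, and only queries to `b` carry
information.

Condition on the randomness of the algorithm, which fixes the rounds in which `b` is queried; let
`N` be their number. Whether `b` is played in a round is then a test between the two biases that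
sees only these `N` tosses. By Le Cam's inequality its errors sum to at least `(1 - 4ε²)^N / 2 ≥ (1
- 4ε²N) / 2` (`le_sum_errors`), and each error costs `ε` in mean reward
(`sum_notPlay_le_sum_regret`, `sum_play_le_sum_regret`). The bound is linear in `N`, so only the
mean of `N` matters after averaging. With `ε` of order `√(k/T)` the two expected regrets sum to
order `εT`, that is `√(kT)`, and one of them is at least half of the sum. -/

/-! ### Product weights on coin tosses and two-point testing. -/

/-- A sum of a product weight against a function that depends only on the coordinates in `S` is
unchanged if the weights off `S` are replaced by others of the same total mass. -/
theorem sum_prod_mul_eq_of_dependsOn {ι : Type*} [Fintype ι] [DecidableEq ι]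
    (S : ι → Prop) [DecidablePred S] {p q : ι → Bool → ℝ} (hS : ∀ s, S s → p s = q s)
    (hm : ∀ s, ∑ c, p s c = ∑ c, q s c) {h : (ι → Bool) → ℝ}
    (hh : ∀ x y, (∀ s, S s → x s = y s) → h x = h y) :
    ∑ x, (∏ s, p s (x s)) * h x = ∑ x, (∏ s, q s (x s)) * h x := by
  let e := Equiv.piEquivPiSubtypeProd S (fun _ => Bool)
  -- The coordinates off `S` factor out through their total masses; the value `true` at which `h`
  -- freezes them is arbitrary.
  have key : ∀ r : ι → Bool → ℝ, ∑ x, (∏ s, r s (x s)) * h x =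
      (∑ y : {s // S s} → Bool, (∏ s : {s // S s}, r s (y s)) * h (e.symm (y, fun _ => true))) *
        ∏ s : {s // ¬ S s}, ∑ c, r s c := by
    intro r
    rw [← e.symm.sum_comp, Fintype.sum_prod_type, Finset.sum_mul]
    refine Finset.sum_congr rfl fun y _ => ?_
    rw [Fintype.prod_sum, Finset.mul_sum]
    refine Finset.sum_congr rfl fun z _ => ?_
    have h1 : h (e.symm (y, z)) = h (e.symm (y, fun _ => true)) := by
      apply hh
      intro s hs
      simp [e, Equiv.piEquivPiSubtypeProd, hs]
    rw [h1, ← Fintype.prod_subtype_mul_prod_subtype S]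
    have h2 : ∀ s : {s // S s}, e.symm (y, z) s = y s := by
      intro s
      simp [e, Equiv.piEquivPiSubtypeProd, s.2]
    have h3 : ∀ s : {s // ¬ S s}, e.symm (y, z) s = z s := by
      intro s
      simp [e, Equiv.piEquivPiSubtypeProd, s.2]
    simp only [h2, h3]
    ring
  rw [key p, key q]
  congr 1
  · refine Finset.sum_congr rfl fun y _ => ?_
    congr 1
    exact Finset.prod_congr rfl fun s _ => by rw [hS s s.2]
  · exact Finset.prod_congr rfl fun s _ => hm s

/-- Le Cam's inequality between the overlap of two weights and their Hellinger affinity. -/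
theorem sq_sum_sqrt_mul_le {α : Type*} [Fintype α] {u v : α → ℝ} (hu : ∀ x, 0 ≤ u x)
    (hv : ∀ x, 0 ≤ v x) (hsu : ∑ x, u x = 1) (hsv : ∑ x, v x = 1) :
    (∑ x, √(u x * v x)) ^ 2 ≤ 2 * ∑ x, min (u x) (v x) := by
  have h0 : ∀ x, 0 ≤ min (u x) (v x) := fun x => le_min (hu x) (hv x)
  have h1 : ∀ x, 0 ≤ max (u x) (v x) := fun x => (hu x).trans (le_max_left _ _)
  -- Cauchy–Schwarz applied to `u * v = min u v * max u v`.
  have hCS := Finset.sum_mul_sq_le_sq_mul_sq Finset.univ (fun x => √(min (u x) (v x)))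
    (fun x => √(max (u x) (v x)))
  simp only [← Real.sqrt_mul (h0 _), min_mul_max, Real.sq_sqrt (h0 _), Real.sq_sqrt (h1 _)] at hCS
  have hmax : ∑ x, max (u x) (v x) ≤ 2 := by
    calc ∑ x, max (u x) (v x) ≤ ∑ x, (u x + v x) := Finset.sum_le_sum fun x _ =>
          max_le (le_add_of_nonneg_right (hv x)) (le_add_of_nonneg_left (hu x))
      _ = 2 := by rw [Finset.sum_add_distrib, hsu, hsv]; norm_num
  have := mul_le_mul_of_nonneg_left hmax (Finset.sum_nonneg fun x (_ : x ∈ Finset.univ) => h0 x)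
  linarith

/-- The probability of the outcome `c` of a coin of bias `p`. -/
def coinWeight (p : ℝ) (c : Bool) : ℝ := if c then p else 1 - p

theorem sum_coinWeight (p : ℝ) : ∑ c, coinWeight p c = 1 := by simp [coinWeight]

theorem coinWeight_nonneg {p : ℝ} (h0 : 0 ≤ p) (h1 : p ≤ 1) (c : Bool) : 0 ≤ coinWeight p c := by
  cases c <;> simp [coinWeight, h0, h1]

theorem sum_prod_coinWeight {ι : Type*} [Fintype ι] [DecidableEq ι] (p : ι → ℝ) :
    ∑ x : ι → Bool, ∏ s, coinWeight (p s) (x s) = 1 := by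
  rw [← Fintype.prod_sum (fun s => coinWeight (p s))]
  simp only [sum_coinWeight, Finset.prod_const_one]

/-- The error probabilities of a test that sees only the tosses in `S`, between two biases at
distance `ε` from `1/2`. -/
theorem le_sum_errors {ι : Type*} [Fintype ι] [DecidableEq ι] (S : ι → Prop) [DecidablePred S]
    {ε : ℝ} (h0 : 0 ≤ ε) (h1 : ε ≤ 1 / 2) {h : (ι → Bool) → ℝ}
    (hh : ∀ x y, (∀ s, S s → x s = y s) → h x = h y) (hh0 : ∀ x, 0 ≤ h x) (hh1 : ∀ x, h x ≤ 1) :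
    (1 - 4 * ε ^ 2 * ∑ s, if S s then 1 else 0) / 2 ≤
      ∑ x : ι → Bool, (∏ s, coinWeight (1 / 2 + ε) (x s)) * (1 - h x) +
        ∑ x : ι → Bool, (∏ s, coinWeight (1 / 2 - ε) (x s)) * h x := by
  -- The test does not see the tosses off `S`, so their bias may be changed to agree with the first
  -- law. Then only the coordinates in `S` lower the affinity.
  let q : ι → ℝ := fun s => if S s then 1 / 2 - ε else 1 / 2 + ε
  have hq0 : ∀ s, 0 ≤ q s := fun s => by dsimp only [q]; split_ifs <;> linarith
  have hq1 : ∀ s, q s ≤ 1 := fun s => by dsimp only [q]; split_ifs <;> linarith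
  rw [sum_prod_mul_eq_of_dependsOn S (p := fun _ => coinWeight (1 / 2 - ε))
    (q := fun s => coinWeight (q s)) (fun s hs => by simp [q, hs])
    (fun s => by simp only [sum_coinWeight]) hh]
  have hu : ∀ x : ι → Bool, 0 ≤ ∏ s, coinWeight (1 / 2 + ε) (x s) := fun x =>
    Finset.prod_nonneg fun s _ => coinWeight_nonneg (by linarith) (by linarith) _
  have hv : ∀ x : ι → Bool, 0 ≤ ∏ s, coinWeight (q s) (x s) := fun x =>
    Finset.prod_nonneg fun s _ => coinWeight_nonneg (hq0 s) (hq1 s) _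
  have hLC := sq_sum_sqrt_mul_le hu hv (sum_prod_coinWeight _) (sum_prod_coinWeight _)
  have hmin : ∑ x : ι → Bool, min (∏ s, coinWeight (1 / 2 + ε) (x s)) (∏ s, coinWeight (q s) (x s))
      ≤ ∑ x : ι → Bool, (∏ s, coinWeight (1 / 2 + ε) (x s)) * (1 - h x) +
        ∑ x : ι → Bool, (∏ s, coinWeight (q s) (x s)) * h x := by
    rw [← Finset.sum_add_distrib]
    refine Finset.sum_le_sum fun x _ => ?_
    have := mul_le_mul_of_nonneg_right (min_le_left (∏ s, coinWeight (1 / 2 + ε) (x s))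
      (∏ s, coinWeight (q s) (x s))) (sub_nonneg.2 (hh1 x))
    have := mul_le_mul_of_nonneg_right (min_le_right (∏ s, coinWeight (1 / 2 + ε) (x s))
      (∏ s, coinWeight (q s) (x s))) (hh0 x)
    linarith
  have haff : (∑ x : ι → Bool, √((∏ s, coinWeight (1 / 2 + ε) (x s)) *
      ∏ s, coinWeight (q s) (x s))) ^ 2 = ∏ s, if S s then 1 - 4 * ε ^ 2 else 1 := by
    have : ∀ x : ι → Bool, √((∏ s, coinWeight (1 / 2 + ε) (x s)) * ∏ s, coinWeight (q s) (x s))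
        = ∏ s, √(coinWeight (1 / 2 + ε) (x s) * coinWeight (q s) (x s)) := by
      intro x
      rw [← Finset.prod_mul_distrib, Real.sqrt_prod]
      exact fun s _ => mul_nonneg (coinWeight_nonneg (by linarith) (by linarith) _)
        (coinWeight_nonneg (hq0 s) (hq1 s) _)
    simp only [this]
    rw [← Fintype.prod_sum (fun s c => √(coinWeight (1 / 2 + ε) c * coinWeight (q s) c)),
      ← Finset.prod_pow]
    refine Finset.prod_congr rfl fun s _ => ?_
    have hpos : 0 ≤ (1 / 2 + ε) * (1 / 2 - ε) := mul_nonneg (by linarith) (by linarith)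
    by_cases hs : S s
    · simp only [q, hs, if_true, Fintype.sum_bool, coinWeight, Bool.false_eq_true, if_false]
      rw [show (1 - (1 / 2 + ε)) * (1 - (1 / 2 - ε)) = (1 / 2 + ε) * (1 / 2 - ε) by ring,
        ← two_mul, mul_pow, Real.sq_sqrt hpos]
      ring
    · simp only [q, hs, if_false, Fintype.sum_bool, coinWeight, Bool.false_eq_true, if_true]
      rw [Real.sqrt_mul_self (by linarith), Real.sqrt_mul_self (by linarith)]
      ring
  rw [haff, Finset.prod_ite] at hLC
  simp only [Finset.prod_const, one_pow, mul_one] at hLC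
  -- Bernoulli's inequality makes the bound linear in the number of visible tosses.
  have hB := one_add_mul_le_pow (a := -(4 * ε ^ 2)) (by nlinarith)
    (Finset.univ.filter S).card
  rw [show (1 : ℝ) + -(4 * ε ^ 2) = 1 - 4 * ε ^ 2 by ring] at hB
  rw [Finset.sum_boole]
  linarith

/-! ### Coins as measures. -/

/-- The law of a coin of bias `p`. -/
noncomputable def coin (p : unitInterval) : Measure Bool :=
  ENNReal.ofReal p • Measure.dirac true + ENNReal.ofReal (1 - p) • Measure.dirac false

instance (p : unitInterval) : IsProbabilityMeasure (coin p) := by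
  constructor
  simp only [coin, Measure.add_apply, Measure.smul_apply, measure_univ, smul_eq_mul, mul_one]
  rw [← ENNReal.ofReal_add p.2.1 (by linarith [p.2.2])]
  simp

theorem coin_real_singleton (p : unitInterval) (c : Bool) :
    (coin p).real {c} = coinWeight p c := by
  have h0 := p.2.1
  have h1 : (0 : ℝ) ≤ 1 - p := by linarith [p.2.2]
  cases c <;> simp [coin, Measure.real, coinWeight, h0, h1]

theorem integral_coin (p : unitInterval) (f : Bool → ℝ) :
    ∫ c, f c ∂coin p = p * f true + (1 - p) * f false := by
  rw [integral_fintype (Integrable.of_finite)]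
  simp [coin_real_singleton, coinWeight]

theorem integral_pi_coin {ι : Type*} [Fintype ι] [DecidableEq ι] (p : unitInterval) (f : (ι → Bool) → ℝ) :
    ∫ x, f x ∂(Measure.pi fun _ : ι => coin p) = ∑ x, (∏ s, coinWeight p (x s)) * f x := by
  rw [integral_fintype (Integrable.of_finite)]
  refine Finset.sum_congr rfl fun x _ => ?_
  simp only [Measure.real, Measure.pi_singleton, ENNReal.toReal_prod, smul_eq_mul]
  congr 1
  exact Finset.prod_congr rfl fun s _ => coin_real_singleton p (x s)

/-! ### The hard reward laws. -/

section HardInstance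

variable {k : ℕ}

/-- The rewards of a round in which arm `b` tosses `c`, arm `a` pays `1/2` and the others `0`. -/
noncomputable def tossReward (a b : Fin k) (c : Bool) (i : Fin k) : ℝ :=
  if i = b then (if c then 1 else 0) else if i = a then 1 / 2 else 0

theorem tossReward_mem_Icc (a b : Fin k) (c : Bool) (i : Fin k) :
    tossReward a b c i ∈ Set.Icc (0 : ℝ) 1 := by
  unfold tossReward
  split_ifs <;> norm_num

/-- Reward laws in which arm `b` tosses a coin of bias `p`, arm `a` pays `1/2` and the others
pay nothing. -/
noncomputable def tossLaw (p : unitInterval) (a b : Fin k) (i : Fin k) : ProbabilityMeasure ℝ :=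
  ⟨(coin p).map fun c => tossReward a b c i,
    Measure.isProbabilityMeasure_map (measurable_of_finite _).aemeasurable⟩

theorem integral_tossLaw (p : unitInterval) (a b i : Fin k) :
    ∫ x, x ∂(tossLaw p a b i : Measure ℝ) =
      if i = b then (p : ℝ) else if i = a then 1 / 2 else 0 := by
  change ∫ x, x ∂((coin p).map fun c => tossReward a b c i) = _
  rw [integral_map (measurable_of_finite _).aemeasurable (by fun_prop), integral_coin]
  unfold tossReward
  split_ifs <;> simp_all
  ring

theorem hasGoodActions_tossLaw (hk : 2 < k) {p : unitInterval} (hp : (1 / 4 : ℝ) ≤ p)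
    {a b : Fin k} (hab : a ≠ b) : HasGoodActions (tossLaw p a b) 2 (1 / 4) := by
  have hcard : ({a, b} : Finset (Fin k)).card = 2 := Finset.card_pair hab
  refine ⟨fun i => ?_, {a, b}, ⟨a, by simp⟩, fun h => ?_, hcard, fun i hi j hj => ?_⟩
  · change ∀ᵐ x ∂((coin p).map fun c => tossReward a b c i), _
    rw [ae_map_iff (p := fun x : ℝ => x ∈ Set.Icc (0 : ℝ) 1)
      (measurable_of_finite _).aemeasurable measurableSet_Icc]
    exact Filter.Eventually.of_forall fun c => tossReward_mem_Icc a b c i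
  · rw [h, Finset.card_univ, Fintype.card_fin] at hcard
    omega
  · simp only [Finset.mem_insert, Finset.mem_singleton, not_or] at hi hj
    rw [integral_tossLaw, integral_tossLaw, if_neg hj.2, if_neg hj.1]
    rcases hi with rfl | rfl
    · rw [if_neg hab, if_pos rfl]; norm_num
    · rw [if_pos rfl]; linarith

/-- Every arm other than `b` has a constant reward, so independent tosses for all the arms give the
same law as one toss, that of `b`. -/
theorem pi_tossLaw (p : unitInterval) (a b : Fin k) :
    (Measure.pi fun i => (tossLaw p a b i : Measure ℝ)) = (coin p).map (tossReward a b) := by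
  change (Measure.pi fun i => (coin p).map fun c => tossReward a b c i) = _
  have : ∀ i, IsProbabilityMeasure ((coin p).map fun c => tossReward a b c i) := fun i =>
    Measure.isProbabilityMeasure_map (measurable_of_finite _).aemeasurable
  rw [← Measure.pi_map_pi (fun i => (measurable_of_finite _).aemeasurable)]
  have h1 : (fun (x : Fin k → Bool) i => tossReward a b (x i) i) =
      tossReward a b ∘ Function.eval b := by
    ext x i
    by_cases h : i = b <;> simp [tossReward, h]
  rw [h1, ← Measure.map_map (measurable_of_finite (tossReward a b)) (measurable_of_finite _),
    (measurePreserving_eval (fun _ : Fin k => coin p) b).map_eq]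

/-- The reward table of the tosses `x` of arm `b`. -/
noncomputable def tossTable {T : ℕ} (a b : Fin k) (x : Fin T → Bool) (t : Fin T) : Fin k → ℝ :=
  tossReward a b (x t)

theorem rewardLaw_tossLaw (T : ℕ) (p : unitInterval) (a b : Fin k) :
    rewardLaw T (tossLaw p a b) =
      (Measure.pi fun _ : Fin T => coin p).map (tossTable a b) := by
  have : IsProbabilityMeasure ((coin p).map (tossReward a b)) :=
    Measure.isProbabilityMeasure_map (measurable_of_finite _).aemeasurable
  simp only [rewardLaw, pi_tossLaw]
  exact (Measure.pi_map_pi (fun _ => (measurable_of_finite _).aemeasurable)).symm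

end HardInstance

/-! ### Measurability, and the expected regret as a finite sum over tosses. -/

theorem measurable_apply_fin {α : Type*} [MeasurableSpace α] {k : ℕ} {f : α → Fin k → ℝ}
    {j : α → Fin k} (hf : Measurable f) (hj : Measurable j) : Measurable fun x => f x (j x) := by
  have happ : Measurable fun q : (Fin k → ℝ) × Fin k => q.1 q.2 :=
    measurable_from_prod_countable_left fun i => measurable_pi_apply i
  exact happ.comp (hf.prodMk hj)

namespace FixedQueryAlgorithm

variable {k T : ℕ} {Ω : Type*} [MeasurableSpace Ω] {P : Measure Ω}

theorem measurable_play (A : FixedQueryAlgorithm k T P) (t : Fin T) :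
    Measurable fun z : Ω × (Fin T → Fin k → ℝ) => A.play z.2 z.1 t := by
  have hobs : Measurable fun z : Ω × (Fin T → Fin k → ℝ) =>
      fun s : Set.Iio t => z.2 s.1 (A.query s.1 z.1) :=
    measurable_pi_lambda _ fun s => measurable_apply_fin
      (f := fun z : Ω × (Fin T → Fin k → ℝ) => z.2 s.1) (by fun_prop)
      ((A.measurable_query s.1).comp measurable_fst)
  exact (A.measurable_act t).comp (measurable_fst.prodMk hobs)

theorem measurable_regret (A : FixedQueryAlgorithm k T P) :
    Measurable fun z : Ω × (Fin T → Fin k → ℝ) => A.regret z.2 z.1 := by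
  unfold regret
  refine Measurable.sub (Measurable.iSup fun i => by fun_prop)
    (Finset.measurable_fun_sum _ fun t _ => ?_)
  exact measurable_apply_fin (f := fun z : Ω × (Fin T → Fin k → ℝ) => z.2 t) (by fun_prop)
    (A.measurable_play t)

theorem integrable_regret_tossTable [IsProbabilityMeasure P] (A : FixedQueryAlgorithm k T P)
    (p : unitInterval) (a b : Fin k) :
    Integrable (fun z : Ω × (Fin T → Bool) => A.regret (tossTable a b z.2) z.1)
      (P.prod (Measure.pi fun _ => coin p)) := by
  -- The regret factors through the tosses and the plays, a finite space on which every function is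
  -- integrable.
  have hG : Measurable fun z : Ω × (Fin T → Bool) => (z.2, A.play (tossTable a b z.2) z.1) := by
    refine measurable_snd.prodMk (measurable_pi_lambda _ fun t => ?_)
    have h2 : Measurable fun z : Ω × (Fin T → Bool) =>
        (z.1, (tossTable a b z.2 : Fin T → Fin k → ℝ)) :=
      measurable_fst.prodMk ((measurable_of_finite (tossTable a b)).comp measurable_snd)
    exact (A.measurable_play t).comp h2
  have := Measure.isProbabilityMeasure_map
    (μ := P.prod (Measure.pi fun _ : Fin T => coin p)) hG.aemeasurable
  have hF : Integrable (fun q : (Fin T → Bool) × (Fin T → Fin k) =>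
      (⨆ i : Fin k, ∑ t : Fin T, tossTable a b q.1 t i) - ∑ t, tossTable a b q.1 t (q.2 t))
      ((P.prod (Measure.pi fun _ : Fin T => coin p)).map
        fun z => (z.2, A.play (tossTable a b z.2) z.1)) := Integrable.of_finite
  exact hF.comp_measurable hG

theorem integrable_sum_regret [IsProbabilityMeasure P] (A : FixedQueryAlgorithm k T P)
    (p : unitInterval) (a b : Fin k) :
    Integrable (fun ω => ∑ x : Fin T → Bool, (∏ s, coinWeight p (x s)) *
      A.regret (tossTable a b x) ω) P := by
  simpa only [integral_pi_coin] using (A.integrable_regret_tossTable p a b).integral_prod_left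

theorem expectedRegret_tossLaw [IsProbabilityMeasure P] (A : FixedQueryAlgorithm k T P)
    (p : unitInterval) (a b : Fin k) :
    A.expectedRegret (tossLaw p a b) = ∫ ω, ∑ x : Fin T → Bool, (∏ s, coinWeight p (x s)) *
      A.regret (tossTable a b x) ω ∂P := by
  have hm : Measurable (Prod.map id (tossTable a b) : Ω × (Fin T → Bool) → _) :=
    measurable_id.prodMap (measurable_of_finite _)
  have h1 := Measure.map_prod_map P (Measure.pi fun _ : Fin T => coin p) measurable_id
    (measurable_of_finite (tossTable a b))
  rw [Measure.map_id] at h1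
  rw [expectedRegret, rewardLaw_tossLaw, h1,
    integral_map hm.aemeasurable A.measurable_regret.aestronglyMeasurable]
  simp only [Prod.map_fst, Prod.map_snd, id]
  rw [integral_prod _ (A.integrable_regret_tossTable p a b)]
  simp only [integral_pi_coin]

/-! ### Regret for fixed randomness of the algorithm. -/

/-- The tosses made in the rounds `s < t` in which arm `b` is queried determine the play. -/
theorem play_tossTable_congr (A : FixedQueryAlgorithm k T P) {a b : Fin k} {ω : Ω} {t : Fin T}
    {x y : Fin T → Bool} (h : ∀ s, s < t → A.query s ω = b → x s = y s) :
    A.play (tossTable a b x) ω t = A.play (tossTable a b y) ω t := by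
  unfold play
  congr 1
  ext s
  by_cases hs : A.query s.1 ω = b
  · simp only [tossTable, h s.1 s.2 hs]
  · simp [tossTable, tossReward, hs]

/-- The reward of a toss is independent of the play in the same round. -/
theorem sum_toss_mul_play (A : FixedQueryAlgorithm k T P) (p : ℝ) (a b : Fin k) (ω : Ω)
    (t : Fin T) (f : Fin k → ℝ) :
    ∑ x : Fin T → Bool, (∏ s, coinWeight p (x s)) *
        ((if x t then 1 else 0) * f (A.play (tossTable a b x) ω t)) =
      ∑ x : Fin T → Bool, (∏ s, coinWeight p (x s)) *
        (p * f (A.play (tossTable a b x) ω t)) := by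
  -- The play in round `t` ignores toss `t`. Absorbed into the weight of coordinate `t`, the
  -- indicator of the toss and the constant `p` both give total mass `p`.
  have key := sum_prod_mul_eq_of_dependsOn (fun s => s ≠ t)
    (p := fun s c => coinWeight p c * if s = t then (if c then 1 else 0) else 1)
    (q := fun s c => coinWeight p c * if s = t then p else 1)
    (h := fun x => f (A.play (tossTable a b x) ω t))
    (fun s hs => by simp [hs])
    (fun s => by
      by_cases hs : s = t <;> simp [hs, coinWeight]
      ring)
    (fun x y hxy => by
      rw [A.play_tossTable_congr fun s hs _ => hxy s hs.ne])
  simp only [Finset.prod_mul_distrib, Finset.prod_ite_eq', Finset.mem_univ, if_true,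
    mul_assoc] at key
  simpa using key

theorem sum_le_regret (A : FixedQueryAlgorithm k T P) (g : Fin T → Fin k → ℝ) (ω : Ω)
    (i : Fin k) : ∑ t, (g t i - g t (A.play g ω t)) ≤ A.regret g ω := by
  rw [Finset.sum_sub_distrib, regret]
  exact sub_le_sub_right (le_ciSup (f := fun i => ∑ t, g t i) (Set.finite_range _).bddAbove i) _

theorem sum_notPlay_le_sum_regret (A : FixedQueryAlgorithm k T P) {p : ℝ} (h0 : 0 ≤ p)
    (h1 : p ≤ 1) (a b : Fin k) (ω : Ω) :
    (p - 1 / 2) * ∑ t, ∑ x : Fin T → Bool, (∏ s, coinWeight p (x s)) *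
        (1 - if A.play (tossTable a b x) ω t = b then 1 else 0) ≤
      ∑ x : Fin T → Bool, (∏ s, coinWeight p (x s)) * A.regret (tossTable a b x) ω := by
  have hw : ∀ x : Fin T → Bool, 0 ≤ ∏ s, coinWeight p (x s) := fun x =>
    Finset.prod_nonneg fun s _ => coinWeight_nonneg h0 h1 _
  -- Compare with always playing `b`: any other arm pays at most `1/2`.
  have hrew : ∀ x : Fin T → Bool, ∑ t, ((if x t then 1 else 0) - 1 / 2) *
      (1 - if A.play (tossTable a b x) ω t = b then 1 else 0) ≤
      A.regret (tossTable a b x) ω := by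
    intro x
    refine le_trans (Finset.sum_le_sum fun t _ => ?_) (A.sum_le_regret _ ω b)
    simp only [tossTable, tossReward, if_true]
    split_ifs <;> norm_num
  refine le_trans (le_of_eq ?_)
    (Finset.sum_le_sum fun x _ => mul_le_mul_of_nonneg_left (hrew x) (hw x))
  simp only [Finset.mul_sum]
  rw [Finset.sum_comm (s := (Finset.univ : Finset (Fin T → Bool)))]
  refine Finset.sum_congr rfl fun t _ => ?_
  have key := A.sum_toss_mul_play p a b ω t (fun i => 1 - if i = b then 1 else 0)
  simp only [sub_mul, mul_sub (∏ s, coinWeight p _) (_ * _) (_ * _), Finset.sum_sub_distrib]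
  rw [key, ← Finset.sum_sub_distrib, ← Finset.sum_sub_distrib]
  exact Finset.sum_congr rfl fun x _ => by ring

theorem sum_play_le_sum_regret (A : FixedQueryAlgorithm k T P) {p : ℝ} (h0 : 0 ≤ p)
    (h1 : p ≤ 1) {a b : Fin k} (hab : a ≠ b) (ω : Ω) :
    (1 / 2 - p) * ∑ t, ∑ x : Fin T → Bool, (∏ s, coinWeight p (x s)) *
        (if A.play (tossTable a b x) ω t = b then 1 else 0) ≤
      ∑ x : Fin T → Bool, (∏ s, coinWeight p (x s)) * A.regret (tossTable a b x) ω := by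
  have hw : ∀ x : Fin T → Bool, 0 ≤ ∏ s, coinWeight p (x s) := fun x =>
    Finset.prod_nonneg fun s _ => coinWeight_nonneg h0 h1 _
  -- Compare with always playing `a`: a round loses `1/2` minus the toss if `b` is played, and
  -- otherwise loses at least `0`.
  have hrew : ∀ x : Fin T → Bool, ∑ t, (1 / 2 - (if x t then 1 else 0)) *
      (if A.play (tossTable a b x) ω t = b then 1 else 0) ≤
      A.regret (tossTable a b x) ω := by
    intro x
    refine le_trans (Finset.sum_le_sum fun t _ => ?_) (A.sum_le_regret _ ω a)
    simp only [tossTable, tossReward, if_true, if_neg hab]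
    split_ifs <;> norm_num
  refine le_trans (le_of_eq ?_)
    (Finset.sum_le_sum fun x _ => mul_le_mul_of_nonneg_left (hrew x) (hw x))
  simp only [Finset.mul_sum]
  rw [Finset.sum_comm (s := (Finset.univ : Finset (Fin T → Bool)))]
  refine Finset.sum_congr rfl fun t _ => ?_
  have key := A.sum_toss_mul_play p a b ω t (fun i => if i = b then 1 else 0)
  simp only [sub_mul, mul_sub (∏ s, coinWeight p _) (_ * _) (_ * _), Finset.sum_sub_distrib]
  rw [key, ← Finset.sum_sub_distrib, ← Finset.sum_sub_distrib]
  exact Finset.sum_congr rfl fun x _ => by ring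

/-- For every outcome of the algorithm's randomness, the regrets under two biases of arm `b` at
distance `ε` from `1/2` are bounded below in terms of the number of queries to `b`. -/
theorem le_sum_regret_add_sum_regret (A : FixedQueryAlgorithm k T P) {ε : ℝ} (h0 : 0 ≤ ε)
    (h1 : ε ≤ 1 / 2) {a b : Fin k} (hab : a ≠ b) (ω : Ω) :
    ε * (T * ((1 - 4 * ε ^ 2 * ∑ s, if A.query s ω = b then 1 else 0) / 2)) ≤
      ∑ x : Fin T → Bool, (∏ s, coinWeight (1 / 2 + ε) (x s)) * A.regret (tossTable a b x) ω +
      ∑ x : Fin T → Bool, (∏ s, coinWeight (1 / 2 - ε) (x s)) * A.regret (tossTable a b x) ω := by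
  have hhi := A.sum_notPlay_le_sum_regret (p := 1 / 2 + ε) (by linarith) (by linarith) a b ω
  have hlo := A.sum_play_le_sum_regret (p := 1 / 2 - ε) (by linarith) (by linarith) hab ω
  rw [add_sub_cancel_left] at hhi
  rw [sub_sub_cancel] at hlo
  refine le_trans ?_ (add_le_add hhi hlo)
  rw [← mul_add, ← Finset.sum_add_distrib]
  refine mul_le_mul_of_nonneg_left ?_ h0
  rw [← nsmul_eq_mul]
  nth_rw 1 [← Fintype.card_fin T]
  refine Finset.card_nsmul_le_sum _ _ _ fun t _ => ?_
  -- The test is granted all the rounds that query `b`, later ones included, so that one bound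
  -- serves every `t`.
  refine le_sum_errors (fun s => A.query s ω = b) h0 h1 (fun x y hxy => ?_) (fun x => ?_)
    (fun x => ?_)
  · rw [A.play_tossTable_congr fun s _ hs => hxy s hs]
  · positivity
  · split_ifs <;> norm_num

/-! ### The expected number of queries to the rarest arm. -/

theorem integrable_query_eq [IsProbabilityMeasure P] (A : FixedQueryAlgorithm k T P) (b : Fin k)
    (s : Fin T) : Integrable (fun ω => if A.query s ω = b then (1 : ℝ) else 0) P := by
  have : IsProbabilityMeasure (P.map (A.query s)) :=
    Measure.isProbabilityMeasure_map (A.measurable_query s).aemeasurable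
  exact (Integrable.of_finite (f := fun i => if i = b then (1 : ℝ) else 0)).comp_measurable
    (A.measurable_query s)

theorem integral_query_eq [IsProbabilityMeasure P] (A : FixedQueryAlgorithm k T P) (b : Fin k)
    (s : Fin T) : ∫ ω, (if A.query s ω = b then (1 : ℝ) else 0) ∂P = (A.queryDist b).toReal := by
  rw [← integral_map (f := fun i => if i = b then (1 : ℝ) else 0)
    (A.measurable_query s).aemeasurable (measurable_of_finite _).aestronglyMeasurable,
    A.map_query, PMF.integral_eq_sum]
  simp

theorem exists_queryDist_le (A : FixedQueryAlgorithm k T P) (hk : 0 < k) :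
    ∃ b, (A.queryDist b).toReal ≤ 1 / k := by
  have : Nonempty (Fin k) := ⟨⟨0, hk⟩⟩
  have hsum : ∑ b, (A.queryDist b).toReal = 1 := by
    rw [← ENNReal.toReal_sum fun b _ => A.queryDist.apply_ne_top b,
      show ∑ b, A.queryDist b = 1 from (tsum_fintype _).symm.trans A.queryDist.tsum_coe,
      ENNReal.toReal_one]
  obtain ⟨b, -, hb⟩ := Finset.exists_le_of_sum_le (s := (Finset.univ : Finset (Fin k)))
    (f := fun b => (A.queryDist b).toReal) (g := fun _ => 1 / (k : ℝ)) Finset.univ_nonempty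
    (by rw [hsum, Finset.sum_const, Finset.card_univ, Fintype.card_fin, nsmul_eq_mul,
          mul_one_div_cancel (by positivity)])
  exact ⟨b, hb⟩

end FixedQueryAlgorithm

/-! ### Choice of `ε` and conclusion. -/

theorem theorem6 :
    ∃ c : ℝ, 0 < c ∧ ∃ Δ : ℝ, 0 < Δ ∧ ∃ m : ℕ,
      ∀ k T : ℕ, 2 < k → k ≤ T →
      ∀ (Ω : Type*) [MeasurableSpace Ω] (P : Measure Ω) [IsProbabilityMeasure P]
        (A : FixedQueryAlgorithm k T P),
        ∃ ν : Fin k → ProbabilityMeasure ℝ,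
          HasGoodActions ν m Δ ∧ c * Real.sqrt (k * T) ≤ A.expectedRegret ν := by
  -- As `ε ≤ 1/4`, the means of `a` and `b` are at least `1/4`, against `0` elsewhere. The constant
  -- `3/64` is half of `(1/4) * (3/8)`, where `εT = √(kT)/4` and `3/8 = (1 - 1/4)/2`.
  refine ⟨3 / 64, by norm_num, 1 / 4, by norm_num, 2, fun k T hk hT Ω _ P _ A => ?_⟩
  have hk0 : (0 : ℝ) < k := by exact_mod_cast (by omega : 0 < k)
  have hkT : (k : ℝ) ≤ T := by exact_mod_cast hT
  have hT0 : (0 : ℝ) < T := hk0.trans_le hkT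
  obtain ⟨b, hb⟩ := A.exists_queryDist_le (by omega)
  have : Nontrivial (Fin k) := Fin.nontrivial_iff_two_le.2 hk.le
  obtain ⟨a, hab⟩ := exists_ne b
  -- This choice gives `4ε² * (T/k) = 1/4`, and `k ≤ T` gives `ε ≤ 1/4`.
  obtain ⟨ε, hε⟩ : ∃ ε : ℝ, ε = √(k / T) / 4 := ⟨_, rfl⟩
  have hε0 : 0 ≤ ε := by rw [hε]; positivity
  have hε1 : ε ≤ 1 / 4 := by
    have : √((k : ℝ) / T) ≤ 1 := Real.sqrt_le_one.2 ((div_le_one hT0).2 hkT)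
    linarith
  have hsq : ε ^ 2 = k / T / 16 := by
    rw [hε, div_pow, Real.sq_sqrt (by positivity)]; norm_num
  have hεT : ε * T = √(k * T) / 4 := by
    rw [hε, div_mul_eq_mul_div, ← Real.sqrt_mul_self hT0.le, ← Real.sqrt_mul (by positivity),
      Real.sqrt_mul_self hT0.le]
    congr 2
    field_simp
  let hi : unitInterval := ⟨1 / 2 + ε, by constructor <;> linarith⟩
  let lo : unitInterval := ⟨1 / 2 - ε, by constructor <;> linarith⟩
  have hquery : ∫ ω, ∑ s, (if A.query s ω = b then (1 : ℝ) else 0) ∂P ≤ T / k := by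
    rw [integral_finsetSum _ fun s _ => A.integrable_query_eq b s]
    simp only [A.integral_query_eq, Finset.sum_const, Finset.card_univ, Fintype.card_fin,
      nsmul_eq_mul]
    calc (T : ℝ) * (A.queryDist b).toReal ≤ T * (1 / k) := by gcongr
      _ = T / k := by ring
  have hint : Integrable (fun ω => ∑ s, if A.query s ω = b then (1 : ℝ) else 0) P :=
    integrable_finsetSum _ fun s _ => A.integrable_query_eq b s
  have hsum : ε * (T * (3 / 8)) ≤
      A.expectedRegret (tossLaw hi a b) + A.expectedRegret (tossLaw lo a b) := by
    rw [A.expectedRegret_tossLaw, A.expectedRegret_tossLaw,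
      ← integral_add (A.integrable_sum_regret hi a b) (A.integrable_sum_regret lo a b)]
    refine le_trans ?_ (integral_mono
      (((((integrable_const 1).sub (hint.const_mul (4 * ε ^ 2))).div_const 2).const_mul
        (T : ℝ)).const_mul ε)
      ((A.integrable_sum_regret hi a b).add (A.integrable_sum_regret lo a b))
      (fun ω => A.le_sum_regret_add_sum_regret hε0 (by linarith) hab ω))
    simp only [Pi.sub_apply]
    rw [integral_const_mul, integral_const_mul, integral_div,
      integral_sub (integrable_const 1) (hint.const_mul _), integral_const_mul]
    have : 4 * ε ^ 2 * ∫ ω, ∑ s, (if A.query s ω = b then (1 : ℝ) else 0) ∂P ≤ 1 / 4 := by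
      calc _ ≤ 4 * ε ^ 2 * (T / k) := by gcongr
        _ = 1 / 4 := by rw [hsq]; field_simp; norm_num
    refine mul_le_mul_of_nonneg_left (mul_le_mul_of_nonneg_left ?_ hT0.le) hε0
    simp only [integral_const, probReal_univ, smul_eq_mul]
    linarith
  have hgoal : ε * (T * (3 / 8)) = 2 * (3 / 64 * √(k * T)) := by
    rw [← mul_assoc, hεT]; ring
  rw [hgoal] at hsum
  by_cases h : 3 / 64 * √(k * T) ≤ A.expectedRegret (tossLaw hi a b)
  · exact ⟨tossLaw hi a b, hasGoodActions_tossLaw hk (show (1 / 4 : ℝ) ≤ 1 / 2 + ε by linarith) hab, h⟩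
  · exact ⟨tossLaw lo a b, hasGoodActions_tossLaw hk (show (1 / 4 : ℝ) ≤ 1 / 2 - ε by linarith) hab,
      by linarith⟩
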